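/- Theorem. There is a universal constant $C>0$ such that the following holds for all integers $n\ge 0$ and $m\ge 1$, every set $\mathcal D\subseteq\{0,1\}^n\times\{0,1\}^m$ and every function $f:\mathcal D\to\{0,1\}$ (a partial Boolean function; it is total if $\mathcal D=\{0,1\}^n\times\{0,1\}^m$): $$D^1(f)\;\le\; C\cdot m\cdot Q_2^1(f)\cdot\max\{1,\log_2 Q_2^1(f)\}$$ (for $Q_2^1(f)=0$ the right-hand side is $0$). In particular $D^1(f)\le C\,m\,Q_2^1(f)\log_2 Q_2^1(f)$ whenever $Q_2^1(f)\ge 2$, that is, $D^1(f)=O\left(m\,Q_2^1(f)\log Q_2^1(f)\right)$. Here $D^1(f)$, the deterministic one-way communication complexity, is the least $k$ for which there are functions $\mu:\{0,1\}^n\to\{0,1\}^k$ (Alice's message) and $g:\{0,1\}^k\times\{0,1\}^m\to\{0,1\}$ (Bob's output) with $g(\mu(x),y)=f(x,y)$ for all $(x,y)\in\mathcal D$. The bounded-error quantum one-way communication complexity $Q_2^1(f)$ is the least $k$ for which there are mixed states $\rho_x$ of $k$ qubits ($x\in\{0,1\}^n$) and two-outcome measurements (POVMs) $\Lambda[y]$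 on $k$ qubits ($y\in\{0,1\}^m$) such that, for all $(x,y)\in\mathcal D$, measuring $\rho_x$ with $\Lambda[y]$ yields the outcome $f(x,y)$ with probability at least $2/3$. -/

import Mathlib

namespace OneWay

open scoped ComplexOrder

/-- The set `{0,1}^k` of bit strings of length `k`. -/
abbrev Bits (k : ℕ) : Type := Fin k → Bool

/-- A mixed state of `k` qubits: a density matrix of size `2^k × 2^k`, whose rows and columns are
indexed by the computational basis `{0,1}^k`. -/
structure QState (k : ℕ) where
  mat : Matrix (Bits k) (Bits k) ℂ
  posSemidef : mat.PosSemidef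
  trace_eq_one : mat.trace = 1

/-- A measurement of `k` qubits with outcomes in `{0,1}`, given by its two POVM elements. -/
structure QMeas (k : ℕ) where
  elt : Bool → Matrix (Bits k) (Bits k) ℂ
  posSemidef : ∀ a, (elt a).PosSemidef
  sum_eq_one : elt false + elt true = 1

/-- The probability that the measurement `M` of the state `ρ` has outcome `a` (Born's rule). -/
noncomputable def QMeas.prob {k : ℕ} (M : QMeas k) (ρ : QState k) (a : Bool) : ℝ :=
  (M.elt a * ρ.mat).trace.re

/-- The (possibly partial) Boolean function `f`, with domain `D ⊆ {0,1}^n × {0,1}^m`, has a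
deterministic one-way protocol with `k` bits of communication: Alice's message is a function of her
input `x`, and Bob's output is a function of the message and his input `y`. -/
def HasDetProtocol {n m : ℕ} {D : Set (Bits n × Bits m)} (f : D → Bool) (k : ℕ) : Prop :=
  ∃ (msg : Bits n → Bits k) (out : Bits k → Bits m → Bool),
    ∀ p : D, out (msg p.1.1) p.1.2 = f p

/-- `f` has a bounded-error quantum one-way protocol with `k` qubits of communication: on input `x`
Alice sends a mixed state `ρ x` of `k` qubits, and on input `y` Bob applies a measurement `M y` to
it, whose outcome is `f (x, y)` with probability at least `2/3` for all `(x, y)` in the domain. -/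
def HasQProtocol {n m : ℕ} {D : Set (Bits n × Bits m)} (f : D → Bool) (k : ℕ) : Prop :=
  ∃ (ρ : Bits n → QState k) (M : Bits m → QMeas k),
    ∀ p : D, 2 / 3 ≤ (M p.1.2).prob (ρ p.1.1) (f p)

/-- Deterministic one-way communication complexity `D¹(f)`. -/
noncomputable def D1 {n m : ℕ} {D : Set (Bits n × Bits m)} (f : D → Bool) : ℕ :=
  sInf {k | HasDetProtocol f k}

/-- Bounded-error quantum one-way communication complexity `Q₂¹(f)`. -/
noncomputable def Q21 {n m : ℕ} {D : Set (Bits n × Bits m)} (f : D → Bool) : ℕ :=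
  sInf {k | HasQProtocol f k}

/-! The two minima are over nonempty sets, so that they are attained. -/

theorem hasDetProtocol_self {n m : ℕ} {D : Set (Bits n × Bits m)} (f : D → Bool) :
    HasDetProtocol f n := by
  classical
  refine ⟨fun x => x, fun x y => if h : (x, y) ∈ D then f ⟨(x, y), h⟩ else false, ?_⟩
  rintro ⟨⟨x, y⟩, h⟩
  simp [h]

theorem HasDetProtocol.hasQProtocol {n m : ℕ} {D : Set (Bits n × Bits m)} {f : D → Bool} {k : ℕ}
    (h : HasDetProtocol f k) : HasQProtocol f k := by
  obtain ⟨msg, out, h⟩ := h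
  refine ⟨fun x => ⟨Matrix.diagonal (Pi.single (msg x) 1), ?_, ?_⟩,
    fun y => ⟨fun a => Matrix.diagonal fun z => if out z y = a then 1 else 0, ?_, ?_⟩, ?_⟩
  · refine Matrix.PosSemidef.diagonal fun z => ?_
    by_cases hz : z = msg x
    · subst hz; simp
    · simp [hz]
  · simp [Matrix.trace_diagonal]
  · intro a
    refine Matrix.PosSemidef.diagonal fun z => ?_
    dsimp only
    split_ifs <;> simp
  · rw [Matrix.diagonal_add, ← Matrix.diagonal_one]
    congr 1
    funext z
    cases out z y <;> simp
  · intro p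
    simp only [QMeas.prob, Matrix.diagonal_mul_diagonal, Matrix.trace_diagonal]
    rw [Finset.sum_eq_single (msg p.1.1)]
    · simp [h p]; norm_num
    · intro z _ hz
      simp [hz]
    · simp

theorem hasDetProtocol_D1 {n m : ℕ} {D : Set (Bits n × Bits m)} (f : D → Bool) :
    HasDetProtocol f (D1 f) :=
  Nat.sInf_mem (s := {k | HasDetProtocol f k}) ⟨n, hasDetProtocol_self f⟩

theorem hasQProtocol_Q21 {n m : ℕ} {D : Set (Bits n × Bits m)} (f : D → Bool) :
    HasQProtocol f (Q21 f) :=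
  Nat.sInf_mem (s := {k | HasQProtocol f k}) ⟨n, (hasDetProtocol_self f).hasQProtocol⟩

end OneWay

/-! Alice's message is a list of corrections that teaches Bob to predict the measurements of her
state ρ. A record of pairs (y, b) has matrix S, the sum of the ±1 observables X favouring b, and Bob
answers y by the sign of tr(S^(2r+1) X), the gradient of a Schatten norm. Suppose each record still
errs on some y whose outcome b has probability at least 2/3. Recording (y, b) raises tr(Sρ) by at
least 1/3, while the error means that the first-order change of the norm is not positive, so by
smoothness its square grows by only O(r + 1) (`schattenPotential_add_le`). On r + 1 qubits the norm
of exponent 2(r + 1) controls tr(Sρ) up to a constant (`sq_trace_mul_le`), so T errors force T²/9 ≤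
2(1 + 8(r + 1)T), hence T = O(r + 1). Thus O(Q) entries of O(m) bits suffice, without any
logarithmic factor. -/

namespace OneWay

open scoped ComplexOrder
open Matrix

/-! ### Trace inequalities by diagonalization -/

section Matrices

variable {ι : Type*} [Fintype ι] [DecidableEq ι]

theorem exists_unitary_diagonal {S : Matrix ι ι ℂ} (hS : S.IsHermitian) :
    ∃ (U : Matrix ι ι ℂ) (ev : ι → ℝ), Uᴴ * U = 1 ∧ U * Uᴴ = 1 ∧
      ∀ a : ℕ, S ^ a = U * diagonal (fun i => ((ev i ^ a : ℝ) : ℂ)) * Uᴴ := by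
  obtain ⟨V, ev, h1, h2, hs⟩ : ∃ (V : Matrix ι ι ℂ) (ev : ι → ℝ), Vᴴ * V = 1 ∧ V * Vᴴ = 1 ∧
      S = V * diagonal (fun i => (ev i : ℂ)) * Vᴴ := by
    refine ⟨hS.eigenvectorUnitary, hS.eigenvalues, Unitary.coe_star_mul_self _,
      Unitary.coe_mul_star_self _, ?_⟩
    conv_lhs => rw [hS.spectral_theorem]
    rw [Unitary.conjStarAlgAut_apply]
    rfl
  refine ⟨V, ev, h1, h2, fun a => ?_⟩
  induction a with
  | zero => simp [h2]
  | succ a ih =>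
    rw [pow_succ, ih, hs]
    set D1 := diagonal (fun i => ((ev i ^ a : ℝ) : ℂ))
    set D2 := diagonal (fun i => (ev i : ℂ))
    have : V * D1 * Vᴴ * (V * D2 * Vᴴ) = V * D1 * (Vᴴ * V) * D2 * Vᴴ := by
      simp only [Matrix.mul_assoc]
    rw [this, h1, Matrix.mul_one, Matrix.mul_assoc V D1 D2, diagonal_mul_diagonal]
    simp [pow_succ]

theorem trace_conj_diagonal {U : Matrix ι ι ℂ} (hU : Uᴴ * U = 1) (v : ι → ℝ) :
    (U * diagonal (fun i => (v i : ℂ)) * Uᴴ).trace.re = ∑ i, v i := by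
  rw [trace_mul_comm, ← Matrix.mul_assoc, hU, Matrix.one_mul, trace_diagonal]
  simp

/-- In an eigenbasis of S take w i j = |X i j|²; its row sums are diagonal entries of X², hence at
most 1. Noncommutative traces become weighted double sums. -/
theorem exists_spectral_data {S X : Matrix ι ι ℂ} (hS : S.IsHermitian) (hX : X.IsHermitian)
    (hX1 : (1 - X * X).PosSemidef) :
    ∃ (ev : ι → ℝ) (w : ι → ι → ℝ), (∀ i j, 0 ≤ w i j) ∧ (∀ i j, w i j = w j i) ∧
      (∀ i, ∑ j, w i j ≤ 1) ∧ (∀ a, (S ^ a).trace.re = ∑ i, ev i ^ a) ∧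
      ∀ a b, (S ^ a * X * S ^ b * X).trace.re = ∑ i, ∑ j, ev i ^ a * ev j ^ b * w i j := by
  obtain ⟨U, ev, h1, h2, hpow⟩ := exists_unitary_diagonal hS
  set W := Uᴴ * X * U with hW
  have hWH : W.IsHermitian := isHermitian_conjTranspose_mul_mul U hX
  have hWs : ∀ i j, W j i = star (W i j) := fun i j => by
    rw [← hWH.apply j i]
  have hsq : ∀ i j, W i j * W j i = ((Complex.normSq (W i j) : ℝ) : ℂ) := fun i j => by
    rw [hWs i j]; exact Complex.mul_conj _
  refine ⟨ev, fun i j => Complex.normSq (W i j), fun i j => Complex.normSq_nonneg _, fun i j => ?_,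
    fun i => ?_, fun a => ?_, fun a b => ?_⟩
  · dsimp only
    rw [hWs i j]; exact (Complex.normSq_conj _).symm
  · have h := hX1.conjTranspose_mul_mul_same U
    have e : Uᴴ * (1 - X * X) * U = 1 - W * W := by
      have : W * W = Uᴴ * X * (U * Uᴴ) * X * U := by simp only [hW, Matrix.mul_assoc]
      rw [this, h2, Matrix.mul_sub, Matrix.sub_mul, Matrix.mul_one, Matrix.mul_one, h1]
      simp only [Matrix.mul_assoc]
    rw [e] at h
    have hd := h.diag_nonneg (i := i)
    have := (Complex.le_def.1 hd).1
    simp only [Matrix.sub_apply, Matrix.one_apply_eq, Matrix.mul_apply, hsq] at this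
    rw [← Complex.ofReal_sum] at this
    simpa using this
  · rw [hpow, trace_conj_diagonal h1]
  · rw [hpow a, hpow b]
    set A := diagonal (fun i => ((ev i ^ a : ℝ) : ℂ))
    set B := diagonal (fun i => ((ev i ^ b : ℝ) : ℂ))
    have : U * A * Uᴴ * X * (U * B * Uᴴ) * X = U * (A * W * B * (Uᴴ * X)) := by
      simp only [hW, Matrix.mul_assoc]
    have e2 : A * W * B * (Uᴴ * X) * U = (A * W) * (B * W) := by
      simp only [hW, Matrix.mul_assoc]
    rw [this, trace_mul_comm, e2, trace]
    simp only [diag_apply, Matrix.mul_apply (M := A * W), Complex.re_sum]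
    refine Finset.sum_congr rfl fun i _ => Finset.sum_congr rfl fun j _ => ?_
    simp only [A, B, diagonal_mul]
    have : ((ev i ^ a : ℝ) : ℂ) * W i j * (((ev j ^ b : ℝ) : ℂ) * W j i)
        = ((ev i ^ a * ev j ^ b * Complex.normSq (W i j) : ℝ) : ℂ) := by
      rw [Complex.ofReal_mul, Complex.ofReal_mul, ← hsq]; ring
    rw [this, Complex.ofReal_re]

theorem mul_pow_le_add_pow (x y : ℝ) {a b r : ℕ} (h : a + b = 2 * r) :
    x ^ a * y ^ b ≤ x ^ (2 * r) + y ^ (2 * r) := by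
  have hx : x ^ (2 * r) = |x| ^ (2 * r) := by rw [pow_mul, pow_mul, sq_abs]
  have hy : y ^ (2 * r) = |y| ^ (2 * r) := by rw [pow_mul, pow_mul, sq_abs]
  calc x ^ a * y ^ b ≤ |x ^ a * y ^ b| := le_abs_self _
    _ = |x| ^ a * |y| ^ b := by rw [abs_mul, abs_pow, abs_pow]
    _ ≤ |x| ^ (2 * r) + |y| ^ (2 * r) := by
      have h0x := abs_nonneg x
      have h0y := abs_nonneg y
      rw [← h]
      rcases le_total |x| |y| with hxy | hxy
      · calc |x| ^ a * |y| ^ b ≤ |y| ^ a * |y| ^ b := by gcongr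
          _ = |y| ^ (a + b) := (pow_add _ _ _).symm
          _ ≤ _ := le_add_of_nonneg_left (by positivity)
      · calc |x| ^ a * |y| ^ b ≤ |x| ^ a * |x| ^ b := by gcongr
          _ = |x| ^ (a + b) := (pow_add _ _ _).symm
          _ ≤ _ := le_add_of_nonneg_right (by positivity)
    _ = _ := by rw [hx, hy]

theorem trace_pow_mul_pow_mul_le {S X : Matrix ι ι ℂ} (hS : S.IsHermitian) (hX : X.IsHermitian)
    (hX1 : (1 - X * X).PosSemidef) {a b r : ℕ} (h : a + b = 2 * r) :
    (S ^ a * X * S ^ b * X).trace.re ≤ 2 * (S ^ (2 * r)).trace.re := by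
  obtain ⟨ev, w, hw0, hws, hw1, htr, htr2⟩ := exists_spectral_data hS hX hX1
  have hev : ∀ i, 0 ≤ ev i ^ (2 * r) := fun i => by rw [pow_mul]; positivity
  rw [htr2, htr, two_mul]
  have key : ∑ i, ∑ j, ev i ^ (2 * r) * w i j ≤ ∑ i, ev i ^ (2 * r) :=
    Finset.sum_le_sum fun i _ => by
      rw [← Finset.mul_sum]
      exact mul_le_of_le_one_right (hev i) (hw1 i)
  calc ∑ i, ∑ j, ev i ^ a * ev j ^ b * w i j
      ≤ ∑ i, ∑ j, (ev i ^ (2 * r) * w i j + ev j ^ (2 * r) * w i j) :=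
        Finset.sum_le_sum fun i _ => Finset.sum_le_sum fun j _ => by
          rw [← add_mul]
          exact mul_le_mul_of_nonneg_right (mul_pow_le_add_pow _ _ h) (hw0 i j)
    _ = ∑ i, ∑ j, ev i ^ (2 * r) * w i j + ∑ i, ∑ j, ev i ^ (2 * r) * w i j := by
        simp only [Finset.sum_add_distrib]
        congr 1
        rw [Finset.sum_comm]
        exact Finset.sum_congr rfl fun i _ => Finset.sum_congr rfl fun j _ => by rw [hws]
    _ ≤ _ := add_le_add key key

theorem trace_pow_even_nonneg {S : Matrix ι ι ℂ} (hS : S.IsHermitian) (r : ℕ) :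
    0 ≤ (S ^ (2 * r)).trace.re := by
  obtain ⟨U, ev, h1, -, hpow⟩ := exists_unitary_diagonal hS
  rw [hpow, trace_conj_diagonal h1]
  exact Finset.sum_nonneg fun i _ => by rw [pow_mul]; positivity

/-- A form of the power mean inequality for traces: `s ^ (r + 1)` is any upper bound of the mean of
the `2 * (r + 1)`-th powers of the eigenvalues. -/
theorem trace_pow_le_of_trace_pow_succ_le {S : Matrix ι ι ℂ} (hS : S.IsHermitian) (r : ℕ) {s : ℝ}
    (hs : 0 < s) (h : (S ^ (2 * (r + 1))).trace.re ≤ Fintype.card ι * s ^ (r + 1)) :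
    (S ^ (2 * r)).trace.re ≤ 2 * Fintype.card ι * s ^ r := by
  obtain ⟨U, ev, h1, -, hpow⟩ := exists_unitary_diagonal hS
  rw [hpow, trace_conj_diagonal h1] at h ⊢
  have hi : ∀ i, ev i ^ (2 * r) ≤ ev i ^ (2 * (r + 1)) / s + s ^ r := fun i => by
    have h0 : 0 ≤ ev i ^ 2 := sq_nonneg _
    rw [pow_mul, pow_mul]
    -- Splitting at s replaces the sharp power mean inequality, at the cost of a factor 2.
    rcases le_total (ev i ^ 2) s with hle | hle
    · exact (pow_le_pow_left₀ h0 hle r).trans (le_add_of_nonneg_left (by positivity))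
    · refine le_trans ?_ (le_add_of_nonneg_right (by positivity))
      rw [le_div_iff₀ hs, pow_succ]
      exact mul_le_mul_of_nonneg_left hle (by positivity)
  calc ∑ i, ev i ^ (2 * r) ≤ ∑ i, (ev i ^ (2 * (r + 1)) / s + s ^ r) :=
        Finset.sum_le_sum fun i _ => hi i
    _ = (∑ i, ev i ^ (2 * (r + 1))) / s + Fintype.card ι * s ^ r := by
        rw [Finset.sum_add_distrib, Finset.sum_div]; simp
    _ ≤ Fintype.card ι * s ^ (r + 1) / s + Fintype.card ι * s ^ r := by gcongr
    _ = _ := by rw [pow_succ]; field_simp; ring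

/-- The diagonal of ρ in an eigenbasis of S is a probability vector, so tr(Sρ) is an average of
eigenvalues and some eigenvalue is at least as large. -/
theorem trace_mul_pow_le {S ρ : Matrix ι ι ℂ} (hS : S.IsHermitian) (hρ : ρ.PosSemidef)
    (hρ1 : ρ.trace = 1) (r : ℕ) (h0 : 0 ≤ (S * ρ).trace.re) :
    (S * ρ).trace.re ^ (2 * r) ≤ (S ^ (2 * r)).trace.re := by
  obtain ⟨U, ev, h1, h2, hpow⟩ := exists_unitary_diagonal hS
  have hP := hρ.conjTranspose_mul_mul_same U
  set P := Uᴴ * ρ * U with hPdef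
  have hP0 : ∀ i, 0 ≤ (P i i).re := fun i => (Complex.le_def.1 (hP.diag_nonneg (i := i))).1
  have hP1 : ∑ i, (P i i).re = 1 := by
    have : P.trace = 1 := by
      rw [hPdef, trace_mul_comm, ← Matrix.mul_assoc, h2, Matrix.one_mul, hρ1]
    have := congrArg Complex.re this
    simpa [trace, Complex.re_sum] using this
  have hSρ : (S * ρ).trace.re = ∑ i, ev i * (P i i).re := by
    have hS1 := hpow 1
    rw [pow_one] at hS1
    rw [hS1, Matrix.mul_assoc, Matrix.mul_assoc, trace_mul_comm]
    have : diagonal (fun i => ((ev i ^ 1 : ℝ) : ℂ)) * (Uᴴ * ρ) * U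
        = diagonal (fun i => ((ev i ^ 1 : ℝ) : ℂ)) * P := by
      simp only [hPdef, Matrix.mul_assoc]
    rw [this, trace]
    simp [diagonal_mul, Complex.re_sum]
  rw [hpow, trace_conj_diagonal h1]
  obtain ⟨i, hi⟩ : ∃ i, (S * ρ).trace.re ≤ ev i := by
    by_contra! hcon
    set c := (S * ρ).trace.re
    have hle : ∀ i ∈ Finset.univ, ev i * (P i i).re ≤ c * (P i i).re := fun i _ =>
      mul_le_mul_of_nonneg_right (hcon i).le (hP0 i)
    obtain ⟨j, hj⟩ : ∃ j, 0 < (P j j).re := by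
      by_contra! hz
      have : ∑ i, (P i i).re ≤ 0 := Finset.sum_nonpos fun i _ => hz i
      linarith
    have := Finset.sum_lt_sum hle ⟨j, Finset.mem_univ j, mul_lt_mul_of_pos_right (hcon j) hj⟩
    rw [← hSρ, ← Finset.mul_sum, hP1, mul_one] at this
    exact lt_irrefl _ this
  calc _ ≤ ev i ^ (2 * r) := pow_le_pow_left₀ h0 hi _
    _ ≤ _ := Finset.single_le_sum (f := fun i => ev i ^ (2 * r))
        (fun j _ => by rw [pow_mul]; positivity) (Finset.mem_univ i)

end Matrices
-- A second-order comparison lemma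
-- In (F^α)'' the term with F'² carries the factor α - 1 ≤ 0 and the term with F'' is at most αc. So
-- F^α lies below the parabola with curvature αc and slope 0 at 0.
theorem rpow_le_of_second_deriv_le {F F' F'' : ℝ → ℝ} {α c : ℝ} (hα0 : 0 < α) (hα1 : α ≤ 1)
    (hF : ∀ t, HasDerivAt F (F' t) t) (hF' : ∀ t, HasDerivAt F' (F'' t) t) (hpos : ∀ t, 0 < F t)
    (h0 : F' 0 ≤ 0) (h2 : ∀ t, F'' t ≤ c * F t ^ (1 - α)) :
    F 1 ^ α ≤ F 0 ^ α + α * c / 2 := by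
  have hd1 : ∀ t, HasDerivAt (fun t => F t ^ α) (F' t * α * F t ^ (α - 1)) t := fun t =>
    (hF t).rpow_const (Or.inl (hpos t).ne')
  have hd2 : ∀ t, HasDerivAt (fun t => F' t * α * F t ^ (α - 1) - α * c * t)
      (F'' t * α * F t ^ (α - 1) + F' t * α * (F' t * (α - 1) * F t ^ (α - 1 - 1)) - α * c) t :=
    fun t => by
      have := (((hF' t).mul_const α).mul ((hF t).rpow_const (p := α - 1) (Or.inl (hpos t).ne'))).sub
        ((hasDerivAt_id t).const_mul (α * c))
      convert! this using 1
      simp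
  have hanti : Antitone (fun t => F' t * α * F t ^ (α - 1) - α * c * t) := by
    refine antitone_of_hasDerivAt_nonpos hd2 fun t => ?_
    have e1 : F'' t * α * F t ^ (α - 1) ≤ α * c := by
      have hp : 0 < F t ^ (α - 1) := Real.rpow_pos_of_pos (hpos t) _
      calc F'' t * α * F t ^ (α - 1) ≤ (c * F t ^ (1 - α)) * α * F t ^ (α - 1) := by
            gcongr; exact h2 t
        _ = α * c * (F t ^ (1 - α) * F t ^ (α - 1)) := by ring
        _ = α * c := by rw [← Real.rpow_add (hpos t)]; simp
    have e2 : F' t * α * (F' t * (α - 1) * F t ^ (α - 1 - 1)) ≤ 0 := by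
      have hp : 0 < F t ^ (α - 1 - 1) := Real.rpow_pos_of_pos (hpos t) _
      have : F' t * α * (F' t * (α - 1) * F t ^ (α - 1 - 1))
          = -((F' t) ^ 2 * α * (1 - α) * F t ^ (α - 1 - 1)) := by ring
      rw [this, neg_nonpos]
      have : 0 ≤ 1 - α := by linarith
      positivity
    show _ ≤ (0 : ℝ)
    linarith
  have hd3 : ∀ t, HasDerivAt (fun t => F t ^ α - α * c / 2 * t ^ 2)
      (F' t * α * F t ^ (α - 1) - α * c * t) t := fun t => by
    have := (hd1 t).sub (((hasDerivAt_id t).pow 2).const_mul (α * c / 2))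
    convert! this using 1
    simp; ring
  have hneg : ∀ t, 0 ≤ t → F' t * α * F t ^ (α - 1) - α * c * t ≤ 0 := fun t ht => by
    refine (hanti ht).trans ?_
    have hp : 0 < F 0 ^ (α - 1) := Real.rpow_pos_of_pos (hpos 0) _
    have : F' 0 * α * F 0 ^ (α - 1) = F' 0 * (α * F 0 ^ (α - 1)) := by ring
    simp only [mul_zero, sub_zero]
    rw [this]
    exact mul_nonpos_of_nonpos_of_nonneg h0 (by positivity)
  have hfin : AntitoneOn (fun t => F t ^ α - α * c / 2 * t ^ 2) (Set.Ici 0) :=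
    antitoneOn_of_deriv_nonpos (convex_Ici 0)
      (fun t _ => (hd3 t).continuousAt.continuousWithinAt)
      (fun t _ => (hd3 t).differentiableAt.differentiableWithinAt)
      (fun t ht => by
        rw [(hd3 t).deriv]
        exact hneg t (interior_subset ht))
  have := hfin (Set.mem_Ici.2 le_rfl) (Set.mem_Ici.2 zero_le_one) zero_le_one
  simp only at this
  linarith

/-! ### Smoothness of the Schatten potential -/

section Matrices

variable {ι : Type*} [Fintype ι] [DecidableEq ι]

section Derivatives

attribute [local instance] Matrix.linftyOpNormedRing Matrix.linftyOpNormedAlgebra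

/-- Z = 1 serves the first derivative of the trace of a power, Z = X the second. -/
theorem hasDerivAt_trace_pow_mul (S X Z : Matrix ι ι ℂ) (n : ℕ) (t : ℝ) :
    HasDerivAt (fun t : ℝ => ((S + t • X) ^ (n + 1) * Z).trace.re)
      (∑ i ∈ Finset.range (n + 1),
        ((S + t • X) ^ (n - i) * X * (S + t • X) ^ i * Z).trace.re) t := by
  have h1 : HasDerivAt (fun t : ℝ => S + t • X) X t := by
    have := ((hasDerivAt_id t).smul_const X).const_add S
    rw [one_smul] at this
    exact this
  have h2 := (h1.fun_pow' (n + 1)).mul_const Z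
  let L : Matrix ι ι ℂ →ₗ[ℝ] ℝ := Complex.reLm ∘ₗ traceLinearMap ι ℝ ℂ
  have h3 := (LinearMap.toContinuousLinearMap L).hasFDerivAt.comp_hasDerivAt t h2
  convert! h3 using 1
  rw [Finset.sum_mul]
  exact (map_sum L _ _).symm

end Derivatives

theorem hasDerivAt_trace_pow (S X : Matrix ι ι ℂ) (n : ℕ) (t : ℝ) :
    HasDerivAt (fun t : ℝ => ((S + t • X) ^ (n + 1)).trace.re)
      ((n + 1) * ((S + t • X) ^ n * X).trace.re) t := by
  have h := hasDerivAt_trace_pow_mul S X 1 n t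
  simp only [Matrix.mul_one] at h
  convert! h using 1
  rw [Finset.sum_congr rfl (g := fun _ => ((S + t • X) ^ n * X).trace.re)]
  · simp
  · intro i hi
    rw [trace_mul_comm, ← Matrix.mul_assoc, ← pow_add]
    congr 5
    have := Finset.mem_range.1 hi
    omega

/-- The square of a regularized, normalized Schatten norm of exponent `2 * (r + 1)`. -/
noncomputable def schattenPotential (r : ℕ) (S : Matrix ι ι ℂ) : ℝ :=
  ((S ^ (2 * (r + 1))).trace.re / Fintype.card ι + 1) ^ (1 / (r + 1 : ℝ))

theorem schattenPotential_zero (r : ℕ) : schattenPotential r (0 : Matrix ι ι ℂ) = 1 := by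
  simp [schattenPotential]

/-- The squared Schatten norm is smooth with constant linear in its exponent: along S + tX the first
derivative at 0 is not positive, and F'' is bounded through the mixed traces tr(S^a X S^b X). -/
theorem schattenPotential_add_le [Nonempty ι] (r : ℕ) {S X : Matrix ι ι ℂ} (hS : S.IsHermitian)
    (hX : X.IsHermitian) (hX1 : (1 - X * X).PosSemidef)
    (hSX : (S ^ (2 * r + 1) * X).trace.re ≤ 0) :
    schattenPotential r (S + X) ≤ schattenPotential r S + 8 * (r + 1) := by
  set d : ℝ := (Fintype.card ι : ℝ) with hd
  have hd0 : 0 < d := by rw [hd]; exact_mod_cast Fintype.card_pos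
  set α : ℝ := 1 / (r + 1 : ℝ) with hα
  have hr : (0 : ℝ) < r + 1 := by positivity
  have hα0 : 0 < α := by positivity
  have hα1 : α ≤ 1 := by
    rw [hα, div_le_one hr]; linarith [(Nat.cast_nonneg r : (0 : ℝ) ≤ r)]
  have hA : ∀ t : ℝ, (S + t • X).IsHermitian := fun t => by
    refine hS.add ?_
    rw [IsHermitian, conjTranspose_smul, hX.eq]; simp
  set F : ℝ → ℝ := fun t => ((S + t • X) ^ (2 * (r + 1))).trace.re / d + 1 with hF
  -- The regularizing 1 keeps F positive, so its real powers are differentiable even at S = 0.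
  have hF1 : ∀ t, 1 ≤ F t := fun t =>
    le_add_of_nonneg_left (div_nonneg (trace_pow_even_nonneg (hA t) _) hd0.le)
  have hpos : ∀ t, 0 < F t := fun t => zero_lt_one.trans_le (hF1 t)
  have hder : ∀ t, HasDerivAt F
      ((2 * r + 2) * ((S + t • X) ^ (2 * r + 1) * X).trace.re / d) t := fun t => by
    have := ((hasDerivAt_trace_pow S X (2 * r + 1) t).div_const d).add_const 1
    convert! this using 2
    push_cast; ring
  have hder2 : ∀ t, HasDerivAt
      (fun t => (2 * r + 2) * ((S + t • X) ^ (2 * r + 1) * X).trace.re / d)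
      ((2 * r + 2) * (∑ i ∈ Finset.range (2 * r + 1),
        ((S + t • X) ^ (2 * r - i) * X * (S + t • X) ^ i * X).trace.re) / d) t := fun t =>
    ((hasDerivAt_trace_pow_mul S X X (2 * r) t).const_mul _).div_const d
  have hbound : ∀ t, (2 * r + 2) * (∑ i ∈ Finset.range (2 * r + 1),
      ((S + t • X) ^ (2 * r - i) * X * (S + t • X) ^ i * X).trace.re) / d
        ≤ 16 * (r + 1) ^ 2 * F t ^ (1 - α) := fun t => by
    have hs : 0 < F t ^ α := Real.rpow_pos_of_pos (hpos t) _
    have hsr : (F t ^ α) ^ r = F t ^ (1 - α) := by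
      rw [← Real.rpow_mul_natCast (hpos t).le]
      congr 1
      rw [hα]; field_simp; ring
    have hsr1 : (F t ^ α) ^ (r + 1) = F t := by
      rw [← Real.rpow_mul_natCast (hpos t).le]
      have : α * ((r + 1 : ℕ) : ℝ) = 1 := by rw [hα]; push_cast; field_simp
      rw [this, Real.rpow_one]
    have htr := trace_pow_le_of_trace_pow_succ_le (hA t) r hs (by
      rw [hsr1, hF, ← hd]
      dsimp only
      rw [mul_add (a := d), mul_div_cancel₀ _ hd0.ne']
      linarith)
    rw [hsr, ← hd] at htr
    have hG : 0 < F t ^ (1 - α) := Real.rpow_pos_of_pos (hpos t) _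
    have hsum : ∑ i ∈ Finset.range (2 * r + 1),
        ((S + t • X) ^ (2 * r - i) * X * (S + t • X) ^ i * X).trace.re
          ≤ ∑ i ∈ Finset.range (2 * r + 1), 2 * (2 * d * F t ^ (1 - α)) :=
      Finset.sum_le_sum fun i hi => by
        have := Finset.mem_range.1 hi
        exact (trace_pow_mul_pow_mul_le (hA t) hX hX1 (r := r) (by omega)).trans (by linarith)
    rw [Finset.sum_const, Finset.card_range, nsmul_eq_mul] at hsum
    push_cast at hsum
    rw [div_le_iff₀ hd0]
    have hdG : 0 ≤ d * F t ^ (1 - α) * (r + 1) := by positivity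
    calc _ ≤ (2 * r + 2 : ℝ) * ((2 * r + 1) * (2 * (2 * d * F t ^ (1 - α)))) := by gcongr
      _ ≤ _ := by linarith
  have h0 : (2 * r + 2) * ((S + (0 : ℝ) • X) ^ (2 * r + 1) * X).trace.re / d ≤ 0 := by
    rw [zero_smul, add_zero]
    exact div_nonpos_of_nonpos_of_nonneg
      (mul_nonpos_of_nonneg_of_nonpos (by positivity) hSX) hd0.le
  have := rpow_le_of_second_deriv_le hα0 hα1 hder hder2 hpos h0 hbound
  have hc : α * (16 * (r + 1) ^ 2) / 2 = 8 * (r + 1) := by rw [hα]; field_simp; ring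
  rw [hc] at this
  simpa [hF, schattenPotential, hα, hd] using this

/-- Undoing the normalization costs only (card ι)^(1/(r + 1)) ≤ 2; this dictates the exponent. -/
theorem sq_trace_mul_le [Nonempty ι] (r : ℕ) {S ρ : Matrix ι ι ℂ} (hS : S.IsHermitian)
    (hρ : ρ.PosSemidef) (hρ1 : ρ.trace = 1) (h0 : 0 ≤ (S * ρ).trace.re)
    (hcard : Fintype.card ι ≤ 2 ^ (r + 1)) :
    (S * ρ).trace.re ^ 2 ≤ 2 * schattenPotential r S := by
  have h := trace_mul_pow_le hS hρ hρ1 (r + 1) h0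
  have hd0 : (0 : ℝ) < Fintype.card ι := by exact_mod_cast Fintype.card_pos
  have hcard' : (Fintype.card ι : ℝ) ≤ 2 ^ (r + 1) := by exact_mod_cast hcard
  have hT := trace_pow_even_nonneg hS (r + 1)
  set T := (S ^ (2 * (r + 1))).trace.re with hTd
  have hP0 : 0 ≤ T / Fintype.card ι + 1 := by positivity
  have hpow : schattenPotential r S ^ (r + 1) = T / Fintype.card ι + 1 := by
    rw [schattenPotential, ← hTd, ← Real.rpow_mul_natCast hP0]
    have : 1 / (r + 1 : ℝ) * ((r + 1 : ℕ) : ℝ) = 1 := by push_cast; field_simp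
    rw [this, Real.rpow_one]
  have hp : 0 ≤ schattenPotential r S := Real.rpow_nonneg hP0 _
  refine le_of_pow_le_pow_left₀ (Nat.succ_ne_zero r) (by positivity) ?_
  rw [← pow_mul, Nat.succ_eq_add_one, mul_pow, hpow]
  refine h.trans ?_
  calc T = Fintype.card ι * (T / Fintype.card ι) := by field_simp
    _ ≤ 2 ^ (r + 1) * (T / Fintype.card ι + 1) := by gcongr; linarith

end Matrices
-- Observables, records and predictions
/-- The observable with value `1` on the outcome `b` and `-1` on the other outcome. -/
def QMeas.observable {k : ℕ} (M : QMeas k) (b : Bool) : Matrix (Bits k) (Bits k) ℂ :=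
  M.elt b - M.elt (!b)

theorem QMeas.elt_add_elt_not {k : ℕ} (M : QMeas k) (b : Bool) : M.elt b + M.elt (!b) = 1 := by
  cases b
  · exact M.sum_eq_one
  · rw [add_comm]; exact M.sum_eq_one

theorem QMeas.isHermitian_observable {k : ℕ} (M : QMeas k) (b : Bool) :
    (M.observable b).IsHermitian :=
  (M.posSemidef b).1.sub (M.posSemidef _).1

theorem QMeas.observable_not {k : ℕ} (M : QMeas k) (b : Bool) :
    M.observable (!b) = -M.observable b := by
  simp [QMeas.observable]

theorem QMeas.posSemidef_one_sub_observable_sq {k : ℕ} (M : QMeas k) (b : Bool) :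
    (1 - M.observable b * M.observable b).PosSemidef := by
  have hE := M.posSemidef b
  have hG := M.posSemidef (!b)
  have hs := M.elt_add_elt_not b
  rw [QMeas.observable]
  set E := M.elt b
  set G := M.elt (!b)
  have hGE : G = 1 - E := by rw [← hs]; abel
  have h1 := hG.conjTranspose_mul_mul_same E
  have h2 := hE.conjTranspose_mul_mul_same G
  rw [hE.1.eq] at h1
  rw [hG.1.eq] at h2
  -- As G = 1 - E commutes with E, the left side is 4EG, and EG = EG(E + G) = EGE + GEG.
  have : 1 - (E - G) * (E - G) = (E * G * E + G * E * G) + (E * G * E + G * E * G)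
      + ((E * G * E + G * E * G) + (E * G * E + G * E * G)) := by
    rw [hGE]; noncomm_ring
  rw [this]
  exact ((h1.add h2).add (h1.add h2)).add ((h1.add h2).add (h1.add h2))

theorem QMeas.trace_observable_mul {k : ℕ} (M : QMeas k) (ρ : QState k) (b : Bool) :
    (M.observable b * ρ.mat).trace.re = 2 * M.prob ρ b - 1 := by
  have h : M.elt (!b) = 1 - M.elt b := by rw [← M.elt_add_elt_not b]; abel
  rw [QMeas.observable, h, QMeas.prob, Matrix.sub_mul, Matrix.sub_mul, Matrix.one_mul, trace_sub,
    trace_sub, ρ.trace_eq_one]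
  simp; ring

section Learner

variable {m k N : ℕ} (M : Bits m → QMeas k)

/-- The sum of the observables of the recorded pairs of a measurement and its correct outcome. -/
noncomputable def recordSum (v : Fin N → Option (Bits m × Bool)) : Matrix (Bits k) (Bits k) ℂ :=
  ∑ i, (v i).elim 0 fun a => (M a.1).observable a.2

/-- The outcome predicted from a record: the sign of the gradient of the Schatten norm of exponent
`2 * (r + 1)`. -/
noncomputable def prediction (r : ℕ) (v : Fin N → Option (Bits m × Bool)) (y : Bits m) : Bool :=
  decide (0 < (recordSum M v ^ (2 * r + 1) * (M y).observable true).trace.re)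

theorem trace_mul_observable_nonpos {r : ℕ} {v : Fin N → Option (Bits m × Bool)} {y : Bits m}
    {b : Bool} (h : prediction M r v y ≠ b) :
    (recordSum M v ^ (2 * r + 1) * (M y).observable b).trace.re ≤ 0 := by
  cases b
  · have h' : 0 < (recordSum M v ^ (2 * r + 1) * (M y).observable true).trace.re := by
      simpa [prediction] using h
    have := (M y).observable_not true
    simp only [Bool.not_true] at this
    rw [this, Matrix.mul_neg, trace_neg, Complex.neg_re]
    linarith
  · simpa [prediction] using h

theorem isHermitian_recordSum (v : Fin N → Option (Bits m × Bool)) :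
    (recordSum M v).IsHermitian := by
  refine isSelfAdjoint_sum _ fun i _ => ?_
  cases v i with
  | none => exact isHermitian_zero
  | some a => exact (M a.1).isHermitian_observable a.2

theorem recordSum_update {v : Fin N → Option (Bits m × Bool)} {i : Fin N} (hi : v i = none)
    (a : Bits m × Bool) :
    recordSum M (Function.update v i (some a)) = recordSum M v + (M a.1).observable a.2 := by
  have h : ∀ w : Fin N → Option (Bits m × Bool), recordSum M w =
      (w i).elim 0 (fun a => (M a.1).observable a.2) +
        ∑ j ∈ Finset.univ.erase i, (w j).elim 0 fun a => (M a.1).observable a.2 := fun w =>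
    (Finset.add_sum_erase _ _ (Finset.mem_univ i)).symm
  rw [h, h v, hi, Function.update_self]
  simp only [Option.elim_some, Option.elim_none, zero_add]
  rw [add_comm]
  congr 1
  refine Finset.sum_congr rfl fun j hj => ?_
  rw [Function.update_of_ne (Finset.ne_of_mem_erase hj)]

end Learner

/-- Every state of `r + 1` qubits admits a record of `163 * (r + 1)` entries whose predictions are
correct for all measurements whose outcome on that state is almost certain. -/
theorem exists_record {m r : ℕ} (M : Bits m → QMeas (r + 1)) (ρ : QState (r + 1)) :
    ∃ v : Fin (163 * (r + 1)) → Option (Bits m × Bool),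
      ∀ y b, 2 / 3 ≤ (M y).prob ρ b → prediction M r v y = b := by
  by_contra! hcon
  -- Errors are recorded one by one; slots from t on stay empty to receive the next.
  have key : ∀ t ≤ 163 * (r + 1), ∃ v : Fin (163 * (r + 1)) → Option (Bits m × Bool),
      (∀ i : Fin (163 * (r + 1)), t ≤ i → v i = none) ∧
      t / 3 ≤ (recordSum M v * ρ.mat).trace.re ∧
      schattenPotential r (recordSum M v) ≤ 1 + 8 * (r + 1) * t := by
    intro t
    induction t with
    | zero =>
      intro _
      refine ⟨fun _ => none, fun _ _ => rfl, ?_⟩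
      have : recordSum M (fun _ : Fin (163 * (r + 1)) => none) = 0 := by simp [recordSum]
      rw [this]
      simp [schattenPotential_zero]
    | succ t ih =>
      intro ht
      obtain ⟨v, hv, hm, hp⟩ := ih (by omega)
      obtain ⟨y, b, hb, hne⟩ := hcon v
      refine ⟨Function.update v ⟨t, ht⟩ (some (y, b)), fun i hi => ?_, ?_, ?_⟩
      · rw [Function.update_of_ne, hv i (by omega)]
        rintro rfl
        simp at hi
      · rw [recordSum_update M (hv ⟨t, ht⟩ le_rfl), Matrix.add_mul, trace_add, Complex.add_re,
          QMeas.trace_observable_mul]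
        push_cast; linarith
      · rw [recordSum_update M (hv ⟨t, ht⟩ le_rfl)]
        have := schattenPotential_add_le r (isHermitian_recordSum M v)
          ((M y).isHermitian_observable b) ((M y).posSemidef_one_sub_observable_sq b)
          (trace_mul_observable_nonpos M hne)
        push_cast; linarith
  obtain ⟨v, -, hm, hp⟩ := key _ le_rfl
  have hm0 : (0 : ℝ) ≤ ((163 * (r + 1) : ℕ) : ℝ) / 3 := by positivity
  have h := sq_trace_mul_le r (isHermitian_recordSum M v) ρ.posSemidef ρ.trace_eq_one
    (hm0.trans hm) (by simp)
  have h2 := pow_le_pow_left₀ hm0 hm 2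
  push_cast at h2 hp
  have hr : (0 : ℝ) ≤ r := Nat.cast_nonneg r
  -- With T = 163(r + 1), T²/9 exceeds 2952(r + 1)², but the upper bound is 2 + 2608(r + 1)².
  nlinarith

/-! ### From records to deterministic protocols -/

theorem hasDetProtocol_of_card_le {n m k : ℕ} {D : Set (Bits n × Bits m)} {f : D → Bool}
    {β : Type*} [Fintype β] (hβ : Fintype.card β ≤ 2 ^ k) (msg : Bits n → β)
    (out : β → Bits m → Bool) (h : ∀ p : D, out (msg p.1.1) p.1.2 = f p) :
    HasDetProtocol f k := by
  obtain ⟨e⟩ : Nonempty (β ↪ Bits k) := Function.Embedding.nonempty_of_card_le (by simpa using hβ)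
  classical
  refine ⟨fun x => e (msg x), fun z y => if hz : ∃ v, e v = z then out hz.choose y else false,
    fun p => ?_⟩
  have hz : ∃ v, e v = e (msg p.1.1) := ⟨_, rfl⟩
  simp only [dif_pos hz, e.injective hz.choose_spec, h p]

theorem HasQProtocol.hasDetProtocol_succ {n m r : ℕ} {D : Set (Bits n × Bits m)} {f : D → Bool}
    (h : HasQProtocol f (r + 1)) : HasDetProtocol f ((m + 2) * (163 * (r + 1))) := by
  obtain ⟨ρ, M, hρM⟩ := h
  choose msg hmsg using fun x => exists_record M (ρ x)
  refine hasDetProtocol_of_card_le ?_ msg (prediction M r) fun p => hmsg _ _ _ (hρM p)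
  -- An entry has 2^(m+1) + 1 ≤ 2^(m+2) values, the extra one being `none`.
  rw [Fintype.card_fun, Fintype.card_fin, pow_mul 2 (m + 2)]
  refine Nat.pow_le_pow_left ?_ _
  simp [pow_succ]

theorem HasQProtocol.hasDetProtocol_zero {n m : ℕ} {D : Set (Bits n × Bits m)} {f : D → Bool}
    (h : HasQProtocol f 0) : HasDetProtocol f 0 := by
  obtain ⟨ρ, M, hρM⟩ := h
  have hmat : ∀ x, (ρ x).mat = 1 := fun x => by
    ext i j
    have := (ρ x).trace_eq_one
    rw [trace, Fintype.sum_unique, diag_apply] at this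
    rw [Subsingleton.elim j i, one_apply_eq, ← this]
    congr 1 <;> exact Subsingleton.elim _ _
  refine ⟨fun _ => default, fun _ y => decide (0 < ((M y).observable true).trace.re),
    fun p => ?_⟩
  have h1 := hρM p
  have h2 := (M p.1.2).trace_observable_mul (ρ p.1.1) (f p)
  rw [hmat, Matrix.mul_one] at h2
  have h3 : 0 < ((M p.1.2).observable (f p)).trace.re := by rw [h2]; linarith
  rcases hf : f p with _ | _
  · have h4 := (M p.1.2).observable_not false
    rw [hf] at h3
    simp only [Bool.not_false] at h4
    dsimp only
    rw [h4, trace_neg, Complex.neg_re]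
    simpa using h3.le
  · rw [hf] at h3
    simpa using h3

theorem D1_le_of_hasDetProtocol {n m k : ℕ} {D : Set (Bits n × Bits m)} {f : D → Bool}
    (h : HasDetProtocol f k) : D1 f ≤ k :=
  Nat.sInf_le h

theorem D1_le_mul_Q21 {n m : ℕ} {D : Set (Bits n × Bits m)} (f : D → Bool) :
    D1 f ≤ (m + 2) * (163 * Q21 f) := by
  have h := hasQProtocol_Q21 f
  generalize Q21 f = k at h
  cases k with
  | zero => exact D1_le_of_hasDetProtocol h.hasDetProtocol_zero
  | succ r => exact D1_le_of_hasDetProtocol h.hasDetProtocol_succ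

end OneWay

theorem mainTheorem2 :
    ∃ C : ℝ, 0 < C ∧ ∀ (n m : ℕ), 1 ≤ m →
      ∀ (D : Set (OneWay.Bits n × OneWay.Bits m)) (f : D → Bool),
        (OneWay.D1 f : ℝ) ≤
          C * ((m : ℝ) * (OneWay.Q21 f : ℝ) * max 1 (Real.logb 2 (OneWay.Q21 f : ℝ))) := by
  -- 489 = 3 · 163, since m + 2 ≤ 3m for m ≥ 1.
  refine ⟨489, by norm_num, fun n m hm D f => ?_⟩
  have hm' : (1 : ℝ) ≤ m := by exact_mod_cast hm
  have hQ : (0 : ℝ) ≤ OneWay.Q21 f := Nat.cast_nonneg _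
  have h : (OneWay.D1 f : ℝ) ≤ (m + 2) * (163 * OneWay.Q21 f) := by
    exact_mod_cast OneWay.D1_le_mul_Q21 f
  calc (OneWay.D1 f : ℝ) ≤ (m + 2) * (163 * OneWay.Q21 f) := h
    _ ≤ (3 * m) * (163 * OneWay.Q21 f) := by gcongr; linarith
    _ = 489 * (m * OneWay.Q21 f * 1) := by ring
    _ ≤ _ := by gcongr; exact le_max_left _ _
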